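/- For integers $k\ge 1$ and $n\ge 0$ let $c\phi_k(n)$ denote the number of $k$-colored generalized Frobenius partitions of $n$, that is, the number of two-rowed arrays $$\begin{pmatrix} a_1 & a_2 & \cdots & a_r\\ b_1 & b_2 & \cdots & b_r\end{pmatrix},\qquad r\ge 0,$$ whose entries are nonnegative integers each carrying one of $k$ colors, where each row is strictly decreasing with respect to the order that compares entries first by value and then, for equal values, by color (so the entries of a row are pairwise distinct as colored integers), and where $n=r+\sum_{i=1}^r a_i+\sum_{i=1}^r b_i$, the sums being taken over the values. Then for all integers $N\ge 0$ and $n\ge 0$, $$c\phi_{1155N+1002}(1155n+908)\equiv 0 \pmod{1155}.$$ -/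

import Mathlib

/-- The `k`-colored generalized Frobenius partitions of `n`: two-rowed arrays
`(a₁ a₂ … a_r ; b₁ b₂ … b_r)` with `r ≥ 0` whose entries are taken from `k` copies (colors) of the
nonnegative integers, each row being strictly decreasing (for the lexicographic order: first by
value, then by color), such that `n = r + ∑ aᵢ + ∑ bᵢ`, where the sums are over the values.
A strictly decreasing row is the same thing as the finite set of its entries `(value, color)`. -/
def coloredFrobeniusPartitions (k n : ℕ) :
    Set (Finset (ℕ × Fin k) × Finset (ℕ × Fin k)) :=
  {P | P.1.card = P.2.card ∧ P.1.card + ∑ a ∈ P.1, a.1 + ∑ b ∈ P.2, b.1 = n}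

/-- There are only finitely many of them, so that counting them by `Set.ncard` is meaningful. -/
theorem coloredFrobeniusPartitions_finite (k n : ℕ) :
    (coloredFrobeniusPartitions k n).Finite := by
  refine Set.Finite.subset (Finset.finite_toSet
    (((Finset.range (n + 1) ×ˢ (Finset.univ : Finset (Fin k))).powerset) ×ˢ
      ((Finset.range (n + 1) ×ˢ (Finset.univ : Finset (Fin k))).powerset))) ?_
  rintro ⟨A, B⟩ ⟨-, h⟩
  have key : ∀ S : Finset (ℕ × Fin k), ∑ a ∈ S, a.1 ≤ n →
      S ⊆ Finset.range (n + 1) ×ˢ (Finset.univ : Finset (Fin k)) := by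
    intro S hS a ha
    have := Finset.single_le_sum (f := fun a : ℕ × Fin k => a.1) (fun _ _ => Nat.zero_le _) ha
    simp only [Finset.mem_product, Finset.mem_range, Finset.mem_univ, and_true]
    omega
  simp only at h
  simp only [Finset.coe_product, Set.mem_prod, Finset.mem_coe, Finset.mem_powerset]
  exact ⟨key A (by omega), key B (by omega)⟩

/-- `cφ_k(n)`, the number of `k`-colored generalized Frobenius partitions of `n`. -/
noncomputable def cphi (k n : ℕ) : ℕ := (coloredFrobeniusPartitions k n).ncard

/-! The number cφ_k(n) is the coefficient of z^0 q^n in ∏ (1 + z q^(i+1))^k (1 + z⁻¹ q^i)^k. Write k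
= pN + r with p prime. Modulo p, the factor raised to the power pN carries only exponents of z and q
divisible by p, so only the r-th power matters, and only in certain residue classes
(`cphi_modEq_zero`). Jacobi's triple product turns it into (∑ z^m q^(m(m+1)/2) / E)^r, where E = ∏
(1 - q^n).

Modulo 3, 5, 7, 11 the number of colors is 0, 2, 1, 1 and the argument is 2, 3, 5, 6. For r = 0 the
r-th power is 1 and nothing is left. For r = 1 the claim reduces to Ramanujan's congruences for 1/E
modulo 7 and 11; for r = 2, to the coefficients of 1/E^2 modulo 5 in the classes 3 - u^2. Each time
1/E^r is a power of E^3 times a p-th power, and E^3 = ∑ (-1)^n (2n+1) q^(n(n+1)/2) lives in few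
classes modulo p (`coeff_pentagonalSeries_cube`). -/

open PowerSeries

/-! ### Generating function as a polynomial in z. -/

/-- The product `∏ (1 + z q ^ (i + 1)) * ∏ (z + q ^ i)` over `i < M`, a polynomial in `z` over the
power series in `q`. -/
noncomputable def thetaProduct (R : Type*) [CommRing R] (M : ℕ) : Polynomial R⟦X⟧ :=
  (∏ i ∈ Finset.range M, (1 + Polynomial.C (X ^ (i + 1)) * Polynomial.X)) *
    ∏ i ∈ Finset.range M, (Polynomial.C (X ^ i) + Polynomial.X)

theorem thetaProduct_pow (R : Type*) [CommRing R] (M k : ℕ) :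
    thetaProduct R M ^ k =
      (∏ x ∈ Finset.range M ×ˢ (Finset.univ : Finset (Fin k)),
        (1 + Polynomial.C (X ^ (x.1 + 1)) * Polynomial.X)) *
      ∏ x ∈ Finset.range M ×ˢ (Finset.univ : Finset (Fin k)),
        (Polynomial.C (X ^ x.1) + Polynomial.X) := by
  simp [thetaProduct, Finset.prod_product, mul_pow, Finset.prod_pow]

theorem mem_powerset_of_mem_coloredFrobeniusPartitions {k n M : ℕ} (h : n < M)
    {P : Finset (ℕ × Fin k) × Finset (ℕ × Fin k)} (hP : P ∈ coloredFrobeniusPartitions k n) :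
    P ∈ (Finset.range M ×ˢ (Finset.univ : Finset (Fin k))).powerset ×ˢ
      (Finset.range M ×ˢ (Finset.univ : Finset (Fin k))).powerset := by
  obtain ⟨-, h2⟩ := hP
  have key : ∀ S : Finset (ℕ × Fin k), ∑ a ∈ S, a.1 ≤ n →
      S ⊆ Finset.range M ×ˢ (Finset.univ : Finset (Fin k)) := by
    intro S hS a ha
    have := Finset.single_le_sum (f := fun a : ℕ × Fin k => a.1) (fun _ _ => Nat.zero_le _) ha
    simp only [Finset.mem_product, Finset.mem_range, Finset.mem_univ, and_true]
    omega
  simp only [Finset.mem_product, Finset.mem_powerset]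
  exact ⟨key _ (by omega), key _ (by omega)⟩

/-- Expanding, a set A of terms from the first product and a set B of constant terms from the second
contribute z^(|A| + kM - |B|), so z^(kM) selects |A| = |B|. Entries are at most n < M, so the
truncation loses nothing. -/
theorem cast_cphi (R : Type*) [CommRing R] {k n M : ℕ} (h : n < M) :
    (cphi k n : R) = coeff n ((thetaProduct R M ^ k).coeff (k * M)) := by
  classical
  set S := Finset.range M ×ˢ (Finset.univ : Finset (Fin k)) with hS
  have hcard : S.card = k * M := by simp [hS, mul_comm]
  have hset : coloredFrobeniusPartitions k n = ↑((S.powerset ×ˢ S.powerset).filter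
      (fun P => P.1.card = P.2.card ∧ P.1.card + ∑ a ∈ P.1, a.1 + ∑ b ∈ P.2, b.1 = n)) := by
    ext P
    simp only [Finset.coe_filter, Set.mem_ofPred_eq]
    exact ⟨fun hP => ⟨mem_powerset_of_mem_coloredFrobeniusPartitions h hP, hP⟩, fun hP => hP.2⟩
  rw [cphi, hset, Set.ncard_coe_finset, Finset.natCast_card_filter, thetaProduct_pow,
    Finset.prod_one_add, Finset.prod_add, Finset.sum_mul_sum, ← Finset.sum_product',
    Polynomial.finsetSum_coeff, map_sum]
  refine Finset.sum_congr rfl fun P hP => ?_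
  simp only [Finset.mem_product, Finset.mem_powerset] at hP
  have hB : (S \ P.2).card + P.2.card = k * M := by
    rw [Finset.card_sdiff_add_card_eq_card hP.2, hcard]
  have : (∏ x ∈ P.1, Polynomial.C (X ^ (x.1 + 1) : R⟦X⟧) * Polynomial.X) *
      ((∏ x ∈ P.2, Polynomial.C (X ^ x.1 : R⟦X⟧)) * ∏ _x ∈ S \ P.2, Polynomial.X) =
      Polynomial.C (X ^ (P.1.card + ∑ a ∈ P.1, a.1 + ∑ b ∈ P.2, b.1)) *
        Polynomial.X ^ (P.1.card + (S \ P.2).card) := by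
    rw [Finset.prod_mul_distrib, ← map_prod, ← map_prod, Finset.prod_pow_eq_pow_sum,
      Finset.prod_pow_eq_pow_sum, Finset.sum_add_distrib]
    simp only [Finset.prod_const, Finset.sum_const, smul_eq_mul, mul_one, pow_add, map_mul]
    ring
  rw [this, Polynomial.coeff_C_mul_X_pow]
  by_cases h1 : P.1.card = P.2.card
  · have h2 : k * M = P.1.card + (S \ P.2).card := by omega
    rw [if_pos h2, coeff_X_pow]
    simp [h1, eq_comm]
  · have h2 : k * M ≠ P.1.card + (S \ P.2).card := by omega
    rw [if_neg h2, if_neg fun h3 => h1 h3.1, map_zero]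

/-! ### Triangular numbers of integers. -/

/-- The triangular numbers `m (m + 1) / 2` for integers `m`. -/
def triangular (m : ℤ) : ℕ := (m * (m + 1) / 2).toNat

theorem two_mul_triangular (m : ℤ) : 2 * (triangular m : ℤ) = m * (m + 1) := by
  have h0 : 0 ≤ m * (m + 1) := by
    rcases le_or_gt 0 m with h | h
    · positivity
    · exact mul_nonneg_of_nonpos_of_nonpos h.le (by omega)
  rw [triangular, Int.toNat_of_nonneg (by omega)]
  exact Int.two_mul_ediv_two_of_even (Int.even_mul_succ_self m)

theorem triangular_add_one (m : ℤ) :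
    (triangular (m + 1) : ℤ) = triangular m + m + 1 := by
  have h1 := two_mul_triangular m
  have h2 := two_mul_triangular (m + 1)
  linarith

theorem natAbs_le_triangular_add_one (m : ℤ) : m.natAbs ≤ triangular m + 1 := by
  have h1 := two_mul_triangular m
  zify
  rcases abs_cases m with ⟨h, h'⟩ | ⟨h, h'⟩ <;> rw [h] <;> nlinarith [sq_nonneg (m + 1)]

theorem le_triangular (m : ℤ) : m ≤ triangular m := by
  have h1 := two_mul_triangular m
  rcases le_or_gt m 0 with h | h <;> nlinarith

theorem triangular_neg_sub_one (m : ℤ) : triangular (-m - 1) = triangular m := by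
  rw [triangular, triangular]
  congr 2
  ring

/-! ### Truncations of Euler's product. -/

section FiniteProduct

/-- The finite product `∏ (1 - q ^ (i + 1))` over `i < n`. -/
noncomputable def eulerProduct (R : Type*) [CommRing R] (n : ℕ) : R⟦X⟧ :=
  ∏ i ∈ Finset.range n, (1 - X ^ (i + 1))

variable (R : Type*) [CommRing R]

theorem eulerProduct_succ (n : ℕ) :
    eulerProduct R (n + 1) = eulerProduct R n * (1 - X ^ (n + 1)) :=
  Finset.prod_range_succ _ _

theorem constantCoeff_eulerProduct (n : ℕ) : constantCoeff (eulerProduct R n) = 1 := by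
  simp [eulerProduct]

theorem isUnit_eulerProduct (n : ℕ) : IsUnit (eulerProduct R n) :=
  isUnit_iff_constantCoeff.2 (by simp [constantCoeff_eulerProduct])

theorem X_pow_dvd_eulerProduct_sub {D m n : ℕ} (hm : D ≤ m + 1) (hmn : m ≤ n) :
    X ^ D ∣ eulerProduct R n - eulerProduct R m := by
  induction n, hmn using Nat.le_induction with
  | base => simp
  | succ n hn ih =>
    rw [eulerProduct_succ, show eulerProduct R n * (1 - X ^ (n + 1)) - eulerProduct R m =
      (eulerProduct R n - eulerProduct R m) - eulerProduct R n * X ^ (n + 1) by ring]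
    exact dvd_sub ih (Dvd.dvd.mul_left (pow_dvd_pow _ (by omega)) _)

theorem X_pow_dvd_eulerProduct_sub_pentagonalSeries {D n : ℕ} (h : D ≤ n + 1) :
    X ^ D ∣ eulerProduct R n - pentagonalSeries R := by
  rw [X_pow_dvd_iff]
  intro d hd
  obtain ⟨m, hm1, hm2⟩ := ((Filter.tendsto_finset_range.eventually
    (coeff_prod_one_sub_X_pow_eventually_eq R d)).and (Filter.eventually_ge_atTop n)).exists
  have h3 := X_pow_dvd_iff.1 (X_pow_dvd_eulerProduct_sub R h hm2) d hd
  rw [map_sub, sub_eq_zero] at h3 ⊢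
  rw [← h3, ← hm1, eulerProduct]

theorem constantCoeff_pentagonalSeries : constantCoeff (pentagonalSeries R) = 1 := by
  have := X_pow_dvd_iff.1 (X_pow_dvd_eulerProduct_sub_pentagonalSeries R (D := 1) (n := 0)
    le_rfl) 0 one_pos
  rw [map_sub, sub_eq_zero] at this
  rw [← coeff_zero_eq_constantCoeff_apply, ← this]
  simp [eulerProduct]

end FiniteProduct

/-! ### Jacobi's triple product. -/

section Field

variable (K : Type*) [Field K]

theorem pentagonalSeries_mul_inv : pentagonalSeries K * (pentagonalSeries K)⁻¹ = 1 :=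
  PowerSeries.mul_inv_cancel _ (by simp [constantCoeff_pentagonalSeries])

/-- The coefficient of `z ^ j` in `thetaProduct K M`. -/
noncomputable def thetaCoeff (M j : ℕ) : K⟦X⟧ := (thetaProduct K M).coeff j

/-- The substitution z → qz shifts the index in both products, so only end factors change. Comparing
coefficients of z gives a first-order recurrence. -/
theorem thetaProduct_functional (M : ℕ) :
    (Polynomial.C (X ^ M) + Polynomial.C X * Polynomial.X) *
        (thetaProduct K M).comp (Polynomial.C X * Polynomial.X) =
      (1 + Polynomial.C (X ^ (M + 1)) * Polynomial.X) * Polynomial.C (X ^ M) *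
        thetaProduct K M := by
  have h0 : (1 + Polynomial.C X * Polynomial.X : Polynomial K⟦X⟧) ≠ 0 := fun h => by
    have := congrArg (Polynomial.coeff · 0) h
    simp at this
  have h1 : (∏ i ∈ Finset.range M,
      (1 + Polynomial.C (X ^ (i + 1)) * (Polynomial.C X * Polynomial.X) : Polynomial K⟦X⟧)) *
        (1 + Polynomial.C X * Polynomial.X) =
      (∏ i ∈ Finset.range M, (1 + Polynomial.C (X ^ (i + 1)) * Polynomial.X)) *
        (1 + Polynomial.C (X ^ (M + 1)) * Polynomial.X) := by
    rw [← Finset.prod_range_succ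
      (fun i => (1 + Polynomial.C (X ^ (i + 1)) * Polynomial.X : Polynomial K⟦X⟧)),
      Finset.prod_range_succ']
    simp only [pow_succ X (_ + 1), map_mul, mul_assoc, zero_add, pow_one]
  have h2 : (Polynomial.C (X ^ M) + Polynomial.C X * Polynomial.X) * ∏ i ∈ Finset.range M,
      (Polynomial.C (X ^ i) + Polynomial.C X * Polynomial.X : Polynomial K⟦X⟧) =
      (1 + Polynomial.C X * Polynomial.X) * Polynomial.C (X ^ M) *
        ∏ i ∈ Finset.range M, (Polynomial.C (X ^ i) + Polynomial.X) := by
    rw [mul_comm, ← Finset.prod_range_succ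
      (fun i => (Polynomial.C (X ^ i) + Polynomial.C X * Polynomial.X : Polynomial K⟦X⟧)),
      Finset.prod_range_succ', mul_comm, mul_assoc]
    have h3 : ∀ i, (Polynomial.C (X ^ (i + 1)) + Polynomial.C X * Polynomial.X : Polynomial K⟦X⟧) =
        Polynomial.C X * (Polynomial.C (X ^ i) + Polynomial.X) := fun i => by
      rw [pow_succ, map_mul]
      ring
    simp only [h3, Finset.prod_mul_distrib, Finset.prod_const, Finset.card_range]
    simp only [map_pow, pow_zero, map_one]
  apply mul_left_cancel₀ h0
  rw [thetaProduct, Polynomial.mul_comp, Polynomial.prod_comp, Polynomial.prod_comp]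
  simp only [Polynomial.add_comp, Polynomial.one_comp, Polynomial.mul_comp, Polynomial.C_comp,
    Polynomial.X_comp]
  linear_combination (Polynomial.C (X ^ M) + Polynomial.C X * Polynomial.X) * (∏ i ∈ Finset.range M,
      (Polynomial.C (X ^ i) + Polynomial.C X * Polynomial.X : Polynomial K⟦X⟧)) * h1 +
      (∏ i ∈ Finset.range M, (1 + Polynomial.C (X ^ (i + 1)) * Polynomial.X)) *
        (1 + Polynomial.C (X ^ (M + 1)) * Polynomial.X) * h2

theorem thetaCoeff_recurrence (M j : ℕ) :
    X ^ M * (1 - X ^ (j + 1)) * thetaCoeff K M (j + 1) =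
      (X ^ (j + 1) - X ^ (2 * M + 1)) * thetaCoeff K M j := by
  have h := congrArg (Polynomial.coeff · (j + 1)) (thetaProduct_functional K M)
  have e1 : ∀ i, ((thetaProduct K M).comp (Polynomial.C X * Polynomial.X)).coeff i =
      thetaCoeff K M i * X ^ i := by
    intro i
    rw [Polynomial.comp_C_mul_X_coeff, thetaCoeff]
  simp only [add_mul, one_mul, Polynomial.coeff_add, mul_assoc, Polynomial.coeff_C_mul,
    Polynomial.coeff_X_mul, e1] at h
  change _ = X ^ M * thetaCoeff K M (j + 1) + X ^ (M + 1) * (X ^ M * thetaCoeff K M j) at h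
  linear_combination -h

theorem thetaCoeff_zero (M : ℕ) : thetaCoeff K M 0 = X ^ triangular (-M) := by
  have h : ∑ i ∈ Finset.range M, i = triangular (-M) := by
    induction M with
    | zero => simp [triangular]
    | succ M ih =>
      have h1 := two_mul_triangular (-M)
      have h2 := two_mul_triangular (-(M + 1 : ℕ))
      rw [Finset.sum_range_succ, ih]
      push_cast at h2
      zify
      linarith
  rw [thetaCoeff, thetaProduct, Polynomial.mul_coeff_zero, Polynomial.coeff_zero_prod,
    Polynomial.coeff_zero_prod, ← h, ← Finset.prod_pow_eq_pow_sum]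
  simp only [Polynomial.coeff_add, Polynomial.coeff_C_zero, Polynomial.coeff_X_zero,
    Polynomial.mul_coeff_zero, Polynomial.coeff_one_zero, mul_zero, add_zero,
    Finset.prod_const_one, one_mul]

/-- Finite form of the Jacobi triple product identity. -/
theorem eulerProduct_mul_thetaCoeff (M j : ℕ) (hj : j ≤ 2 * M) :
    eulerProduct K j * eulerProduct K (2 * M - j) * thetaCoeff K M j =
      X ^ triangular (j - M) * eulerProduct K (2 * M) := by
  induction j with
  | zero => simp [thetaCoeff_zero, eulerProduct, mul_comm]
  | succ j ih =>
    have ih := ih (by omega)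
    obtain ⟨l, hl⟩ : ∃ l, 2 * M = j + 1 + l := ⟨2 * M - (j + 1), by omega⟩
    have hT : M + triangular ((j + 1 : ℕ) - M) = j + 1 + triangular (j - M) := by
      have h := triangular_add_one (j - M)
      rw [show (j : ℤ) - M + 1 = ((j + 1 : ℕ) : ℤ) - M by push_cast; ring] at h
      omega
    have h := thetaCoeff_recurrence K M j
    rw [hl, show j + 1 + l - j = l + 1 by omega, eulerProduct_succ] at ih
    rw [hl, show j + 1 + l + 1 = (j + 1) + (l + 1) by ring, pow_add X (j + 1) (l + 1)] at h
    rw [hl, show j + 1 + l - (j + 1) = l by omega, eulerProduct_succ]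
    apply mul_left_cancel₀ (pow_ne_zero M (X_ne_zero (R := K)))
    rw [← mul_assoc (X ^ M) (X ^ _), ← pow_add, hT, pow_add X (j + 1) (triangular _),
      mul_assoc (X ^ (j + 1)), ← ih]
    linear_combination eulerProduct K j * eulerProduct K l * h

theorem natDegree_thetaProduct_le (M : ℕ) : (thetaProduct K M).natDegree ≤ 2 * M := by
  rw [thetaProduct, two_mul]
  refine Polynomial.natDegree_mul_le_of_le ?_ ?_
  · refine (Polynomial.natDegree_prod_le _ _).trans ((Finset.sum_le_card_nsmul _ _ 1 ?_).trans ?_)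
    · intro i _
      compute_degree
    · simp
  · refine (Polynomial.natDegree_prod_le _ _).trans ((Finset.sum_le_card_nsmul _ _ 1 ?_).trans ?_)
    · intro i _
      compute_degree
    · simp

/-- Truncated form of the Jacobi triple product identity. -/
theorem X_pow_dvd_thetaCoeff_sub {D M : ℕ} (hM : 2 * D ≤ M) (j : ℕ) :
    X ^ D ∣ thetaCoeff K M j - X ^ triangular (j - M) * (pentagonalSeries K)⁻¹ := by
  rcases lt_or_ge (2 * M) j with hj | hj
  · rw [thetaCoeff, Polynomial.coeff_eq_zero_of_natDegree_lt
      ((natDegree_thetaProduct_le K M).trans_lt hj), zero_sub, dvd_neg]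
    refine Dvd.dvd.mul_right (pow_dvd_pow _ ?_) _
    have := natAbs_le_triangular_add_one (j - M)
    omega
  have h := eulerProduct_mul_thetaCoeff K M j hj
  rcases le_or_gt D (triangular (j - M)) with hT | hT
  · refine dvd_sub ?_ (Dvd.dvd.mul_right (pow_dvd_pow _ hT) _)
    rw [← ((isUnit_eulerProduct K j).mul (isUnit_eulerProduct K (2 * M - j))).dvd_mul_left, h]
    exact Dvd.dvd.mul_right (pow_dvd_pow _ hT) _
  -- Here |j - M| ≤ D, and 2D ≤ M then makes j and 2M - j at least D, so all three Euler products
  -- agree with E to order D.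
  · have hb := natAbs_le_triangular_add_one (j - M)
    have e : ∀ n, D ≤ n + 1 → Ideal.Quotient.mk (Ideal.span {(X : K⟦X⟧) ^ D}) (eulerProduct K n) =
        Ideal.Quotient.mk (Ideal.span {(X : K⟦X⟧) ^ D}) (pentagonalSeries K) := fun n hn => by
      rw [Ideal.Quotient.eq, Ideal.mem_span_singleton]
      exact X_pow_dvd_eulerProduct_sub_pentagonalSeries K hn
    rw [← Ideal.mem_span_singleton, ← Ideal.Quotient.eq]
    replace h := congrArg (Ideal.Quotient.mk (Ideal.span {(X : K⟦X⟧) ^ D})) h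
    have h1 := congrArg (Ideal.Quotient.mk (Ideal.span {(X : K⟦X⟧) ^ D})) (pentagonalSeries_mul_inv K)
    rw [map_mul, map_mul, map_mul, e j (by omega), e (2 * M - j) (by omega),
      e (2 * M) (by omega)] at h
    rw [map_mul, map_one] at h1
    rw [map_mul]
    linear_combination Ideal.Quotient.mk (Ideal.span {(X : K⟦X⟧) ^ D}) (pentagonalSeries K)⁻¹ ^ 2 * h +
      (Ideal.Quotient.mk (Ideal.span {(X : K⟦X⟧) ^ D}) (X ^ triangular (j - M)) *
        Ideal.Quotient.mk (Ideal.span {(X : K⟦X⟧) ^ D}) (pentagonalSeries K)⁻¹ -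
        Ideal.Quotient.mk (Ideal.span {(X : K⟦X⟧) ^ D}) (thetaCoeff K M j) *
          (1 + Ideal.Quotient.mk (Ideal.span {(X : K⟦X⟧) ^ D}) (pentagonalSeries K) *
            Ideal.Quotient.mk (Ideal.span {(X : K⟦X⟧) ^ D}) (pentagonalSeries K)⁻¹)) * h1

end Field

/-! ### Residue classes of exponents and p-th powers. -/

section Residue

/-- The part of a power series whose exponents lie in the class `c` modulo `p`. -/
noncomputable def residuePart {R : Type*} [Semiring R] {p : ℕ} (c : ZMod p) : R⟦X⟧ →+ R⟦X⟧ where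
  toFun f := PowerSeries.mk fun d => if (d : ZMod p) = c then coeff d f else 0
  map_zero' := by ext; simp
  map_add' f g := by ext; simp [ite_add_zero]

theorem coeff_residuePart {R : Type*} [Semiring R] {p : ℕ} (c : ZMod p) (f : R⟦X⟧) (d : ℕ) :
    coeff d (residuePart c f) = if (d : ZMod p) = c then coeff d f else 0 := by
  simp [residuePart]

theorem residuePart_eq_zero_iff {R : Type*} [Semiring R] {p : ℕ} {c : ZMod p} {f : R⟦X⟧} :
    residuePart c f = 0 ↔ ∀ d : ℕ, (d : ZMod p) = c → coeff d f = 0 := by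
  simp [PowerSeries.ext_iff, coeff_residuePart]

theorem residuePart_mul {R : Type*} [Semiring R] {p : ℕ} [NeZero p] (c : ZMod p) (f g : R⟦X⟧) :
    residuePart c (f * g) = ∑ i : ZMod p, residuePart i f * residuePart (c - i) g := by
  ext d
  rw [coeff_residuePart, map_sum]
  simp only [coeff_mul, coeff_residuePart]
  rw [Finset.sum_comm]
  split_ifs with h
  · refine Finset.sum_congr rfl fun x hx => ?_
    rw [Finset.HasAntidiagonal.mem_antidiagonal] at hx
    have hx' : (x.1 : ZMod p) + x.2 = c := by rw [← h, ← hx]; push_cast; rfl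
    rw [Finset.sum_eq_single (x.1 : ZMod p)]
    · rw [if_pos rfl, if_pos (by rw [← hx']; ring)]
    · intro i _ hi
      rw [if_neg hi.symm, zero_mul]
    · simp
  · refine (Finset.sum_eq_zero fun x hx => Finset.sum_eq_zero fun i _ => ?_).symm
    rw [Finset.HasAntidiagonal.mem_antidiagonal] at hx
    beta_reduce
    by_cases h1 : (x.1 : ZMod p) = i
    · rw [if_neg (c := (x.2 : ZMod p) = c - i), mul_zero]
      intro h2
      apply h
      rw [← hx]
      push_cast
      rw [h1, h2]
      ring
    · rw [if_neg h1, zero_mul]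

variable {p : ℕ} [Fact p.Prime]

theorem coeff_pow_prime_of_not_dvd {d : ℕ} (hd : ¬ p ∣ d) (f : (ZMod p)⟦X⟧) :
    coeff d (f ^ p) = 0 := by
  have hp : p ≠ 0 := (Fact.out : p.Prime).ne_zero
  rw [← MvPowerSeries.map_frobenius_expand p hp]
  have : coeff d (PowerSeries.map (frobenius (ZMod p) p) (PowerSeries.expand p hp f)) = 0 := by
    rw [coeff_map, coeff_expand_of_not_dvd _ _ _ hd, map_zero]
  exact this

theorem residuePart_pow_prime {c : ZMod p} (hc : c ≠ 0) (f : (ZMod p)⟦X⟧) :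
    residuePart c (f ^ p) = 0 :=
  residuePart_eq_zero_iff.2 fun d hd => coeff_pow_prime_of_not_dvd
    (fun h => hc (by rw [← hd]; exact (ZMod.natCast_eq_zero_iff _ _).2 h)) f

theorem residuePart_mul_pow_prime (c : ZMod p) (f g : (ZMod p)⟦X⟧) :
    residuePart c (f * g ^ p) = residuePart c f * residuePart (0 : ZMod p) (g ^ p) := by
  rw [residuePart_mul, Finset.sum_eq_single c]
  · rw [sub_self]
  · intro i _ hi
    rw [residuePart_pow_prime (sub_ne_zero.2 hi.symm), mul_zero]
  · simp

instance : CharP (ZMod p)⟦X⟧ p := charP_of_injective_ringHom (C_injective (R := ZMod p)) p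

/-- Cofactors of the p-th power part have z-exponent ≡ (pN + r)M ≡ rM and q-exponent ≡ n modulo p.
-/
theorem cphi_modEq_zero {n : ℕ} (M N r : ℕ) (hM : n < M)
    (H : ∀ j v : ℕ, v ≤ n → (v : ZMod p) = n → (j : ZMod p) = r * M →
      coeff v ((thetaProduct (ZMod p) M ^ r).coeff j) = 0) :
    cphi (p * N + r) n ≡ 0 [MOD p] := by
  have hp : p ≠ 0 := (Fact.out : p.Prime).ne_zero
  rw [← ZMod.natCast_eq_natCast_iff, cast_cphi (ZMod p) hM, pow_add, mul_comm p N, pow_mul,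
    Polynomial.coeff_mul, map_sum, Nat.cast_zero]
  refine Finset.sum_eq_zero fun x hx => ?_
  rw [Finset.HasAntidiagonal.mem_antidiagonal] at hx
  rw [← Polynomial.map_frobenius_expand, Polynomial.coeff_map,
    Polynomial.coeff_expand (Nat.pos_of_ne_zero hp)]
  split_ifs with h
  · rw [frobenius_def, coeff_mul]
    refine Finset.sum_eq_zero fun y hy => ?_
    rw [Finset.HasAntidiagonal.mem_antidiagonal] at hy
    by_cases hy1 : p ∣ y.1
    · rw [H x.2 y.2 (by omega), mul_zero]
      · rw [← hy, Nat.cast_add, (ZMod.natCast_eq_zero_iff _ _).2 hy1, zero_add]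
      · have := congrArg (Nat.cast : ℕ → ZMod p) hx
        push_cast at this
        rw [(ZMod.natCast_eq_zero_iff _ _).2 h, CharP.cast_eq_zero (ZMod p) p] at this
        linear_combination this
    · rw [coeff_pow_prime_of_not_dvd hy1, zero_mul]
  · simp

end Residue

/-! ### Jacobi's identity for E^3 modulo p. -/

section Cube

/-- Differentiate in z at z = -1: the factor q^0 + z vanishes there, so only the term
differentiating it survives. -/
theorem sum_thetaCoeff_mul (K : Type*) [Field K] (M : ℕ) :
    ∑ j ∈ Finset.range (2 * (M + 1) + 1), thetaCoeff K (M + 1) j * C ((j : K) * (-1) ^ (j - 1)) =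
      (-1) ^ M * (eulerProduct K (M + 1) * eulerProduct K M) := by
  have h1 := Polynomial.derivative_eval (thetaProduct K (M + 1)) (-1)
  rw [Polynomial.sum_over_range' _ (by simp) (2 * (M + 1) + 1)
    (Nat.lt_succ_of_le (natDegree_thetaProduct_le K (M + 1)))] at h1
  simp only [thetaCoeff, map_mul, map_pow, map_neg, map_one, map_natCast]
  simp only [← mul_assoc (Polynomial.coeff _ _)]
  rw [← h1, thetaProduct,
    Finset.prod_range_succ' (fun i => (Polynomial.C (X ^ i) + Polynomial.X : Polynomial K⟦X⟧)) M,
    ← mul_assoc]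
  simp only [Polynomial.derivative_mul, Polynomial.derivative_add, Polynomial.eval_add,
    Polynomial.eval_mul, pow_zero, map_one, Polynomial.derivative_one, Polynomial.derivative_X,
    Polynomial.eval_one, Polynomial.eval_X, add_neg_cancel, mul_zero,
    zero_add, mul_one, Polynomial.eval_prod, Polynomial.eval_C]
  rw [eulerProduct, eulerProduct, mul_left_comm, ← Finset.card_range M, ← Finset.prod_const,
    Finset.card_range, ← Finset.prod_mul_distrib]
  congr 1
  · exact Finset.prod_congr rfl fun i _ => by ring
  · exact Finset.prod_congr rfl fun i _ => by ring

/-- A consequence of Jacobi's identity `∏ (1 - q ^ n) ^ 3 = ∑ (-1) ^ n (2 n + 1) q ^ (n (n + 1) / 2)`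
modulo `p`. -/
theorem coeff_pentagonalSeries_cube {p : ℕ} [Fact p.Prime] {d : ℕ}
    (h : ∀ x : ZMod p, x ^ 2 = 8 * d + 1 → x = 0) :
    coeff d (pentagonalSeries (ZMod p) ^ 3) = 0 := by
  -- With M = 2d + 2 factors the triple product is accurate to order d + 1; since 2d + 1 is odd, the
  -- sign is -1.
  have h1 := sum_thetaCoeff_mul (ZMod p) (2 * d + 1)
  have h2 := pentagonalSeries_mul_inv (ZMod p)
  have h3 : X ^ (d + 1) ∣ eulerProduct (ZMod p) (2 * d + 1 + 1) * eulerProduct (ZMod p) (2 * d + 1)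
      - pentagonalSeries (ZMod p) ^ 2 := by
    have e1 := X_pow_dvd_eulerProduct_sub_pentagonalSeries (ZMod p)
      (show d + 1 ≤ 2 * d + 1 + 1 + 1 by omega)
    have e2 := X_pow_dvd_eulerProduct_sub_pentagonalSeries (ZMod p)
      (show d + 1 ≤ 2 * d + 1 + 1 by omega)
    convert dvd_add (e1.mul_right (eulerProduct (ZMod p) (2 * d + 1)))
      (e2.mul_right (pentagonalSeries (ZMod p))) using 1
    ring
  have h4 : X ^ (d + 1) ∣ ∑ j ∈ Finset.range (2 * (2 * d + 1 + 1) + 1),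
      (thetaCoeff (ZMod p) (2 * d + 1 + 1) j -
        X ^ triangular (j - (2 * d + 1 + 1 : ℕ)) * (pentagonalSeries (ZMod p))⁻¹) *
        C ((j : ZMod p) * (-1) ^ (j - 1)) :=
    Finset.dvd_sum fun j _ => (X_pow_dvd_thetaCoeff_sub (ZMod p) (by omega) j).mul_right _
  have h5 : X ^ (d + 1) ∣ pentagonalSeries (ZMod p) ^ 3 +
      ∑ j ∈ Finset.range (2 * (2 * d + 1 + 1) + 1), C ((j : ZMod p) * (-1) ^ (j - 1)) *
        X ^ triangular (j - (2 * d + 1 + 1 : ℕ)) := by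
    have e3 : ∑ j ∈ Finset.range (2 * (2 * d + 1 + 1) + 1),
        X ^ triangular (j - (2 * d + 1 + 1 : ℕ)) * (pentagonalSeries (ZMod p))⁻¹ *
          C ((j : ZMod p) * (-1) ^ (j - 1)) = (pentagonalSeries (ZMod p))⁻¹ *
        ∑ j ∈ Finset.range (2 * (2 * d + 1 + 1) + 1), C ((j : ZMod p) * (-1) ^ (j - 1)) *
          X ^ triangular (j - (2 * d + 1 + 1 : ℕ)) := by
      rw [Finset.mul_sum]
      exact Finset.sum_congr rfl fun j _ => by ring
    simp only [sub_mul, Finset.sum_sub_distrib] at h4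
    rw [h1, e3, Odd.neg_one_pow ⟨d, rfl⟩] at h4
    convert dvd_sub (h4.mul_left (-pentagonalSeries (ZMod p)))
      (h3.mul_left (pentagonalSeries (ZMod p))) using 1
    linear_combination -(∑ j ∈ Finset.range (2 * (2 * d + 1 + 1) + 1),
      C ((j : ZMod p) * (-1) ^ (j - 1)) * X ^ triangular (j - (2 * d + 1 + 1 : ℕ))) * h2
  have h6 := X_pow_dvd_iff.1 h5 d (Nat.lt_succ_self d)
  rw [map_add, map_sum] at h6
  rw [← h6, left_eq_add]
  simp only [coeff_C_mul, coeff_X_pow, mul_ite, mul_one, mul_zero]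
  rw [← Finset.sum_filter]
  have key : ∀ j ∈ Finset.filter (fun j : ℕ => d = triangular (j - (2 * d + 1 + 1 : ℕ)))
      (Finset.range (2 * (2 * d + 1 + 1) + 1)), 1 ≤ j ∧ j + 2 ≤ 2 * (2 * d + 1 + 1) ∧
        d = triangular (j - (2 * d + 1 + 1 : ℕ)) := by
    intro j hj
    have hj := (Finset.mem_filter.1 hj).2
    have := natAbs_le_triangular_add_one (j - (2 * d + 1 + 1 : ℕ))
    have := le_triangular (j - (2 * d + 1 + 1 : ℕ))
    rw [← hj] at *
    exact ⟨by omega, by omega, hj⟩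
  -- For M = 2d + 2, the map j ↦ 2M - 1 - j sends m = j - M to -1 - m, which has the same triangular
  -- number; it has no fixed point since 2M - 1 is odd. Paired weights add up to ±(2m + 1), whose
  -- square is 8d + 1, so `h` makes the sum zero.
  refine Finset.sum_involution (fun j _ => 2 * (2 * d + 1 + 1) - 1 - j) ?_ ?_ ?_ ?_
  · intro j hj
    obtain ⟨hj1, hj2, hj3⟩ := key j hj
    obtain ⟨i, rfl⟩ : ∃ i, j = i + 1 := ⟨j - 1, by omega⟩
    have hsq := two_mul_triangular ((i + 1 : ℕ) - (2 * d + 1 + 1 : ℕ))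
    rw [← hj3] at hsq
    have hsq := congrArg (Int.cast : ℤ → ZMod p) hsq
    push_cast at hsq
    have hx := h (2 * (i - (2 * d + 1)) + 1) (by linear_combination (-4) * hsq)
    rcases Nat.even_or_odd i with hi | hi
    · rw [show i + 1 - 1 = i by omega, hi.neg_one_pow, Odd.neg_one_pow (by
        rw [Nat.odd_iff]; rw [Nat.even_iff] at hi; omega),
        Nat.cast_sub (by omega), Nat.cast_sub (by omega)]
      push_cast
      linear_combination hx
    · rw [show i + 1 - 1 = i by omega, hi.neg_one_pow, Even.neg_one_pow (by
        rw [Nat.even_iff]; rw [Nat.odd_iff] at hi; omega),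
        Nat.cast_sub (by omega), Nat.cast_sub (by omega)]
      push_cast
      linear_combination -hx
  · intro j hj _
    have := key j hj
    omega
  · intro j hj
    obtain ⟨hj1, hj2, hj3⟩ := key j hj
    refine Finset.mem_filter.2 ⟨Finset.mem_range.2 (by omega), ?_⟩
    rw [show (((2 * (2 * d + 1 + 1) - 1 - j : ℕ) : ℤ) - (2 * d + 1 + 1 : ℕ)) =
      -(j - (2 * d + 1 + 1 : ℕ)) - 1 by omega, triangular_neg_sub_one]
    exact hj3
  · intro j hj
    have := key j hj
    omega

end Cube

/-! ### Congruences modulo 3, 5, 7 and 11. -/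

section Congruences

instance : Fact (Nat.Prime 5) := ⟨by norm_num⟩

instance : Fact (Nat.Prime 7) := ⟨by norm_num⟩

instance : Fact (Nat.Prime 11) := ⟨by norm_num⟩

theorem residuePart_pentagonalSeries_cube {p : ℕ} [Fact p.Prime] {c : ZMod p}
    (h : ∀ x : ZMod p, x ^ 2 = 8 * c + 1 → x = 0) :
    residuePart c (pentagonalSeries (ZMod p) ^ 3) = 0 :=
  residuePart_eq_zero_iff.2 fun _ hd => coeff_pentagonalSeries_cube (by rwa [hd])

theorem residuePart_mul_eq_zero {R : Type*} [Semiring R] {p : ℕ} [NeZero p] {c : ZMod p}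
    {f g : R⟦X⟧} (h : ∀ i : ZMod p, residuePart i f = 0 ∨ residuePart (c - i) g = 0) :
    residuePart c (f * g) = 0 := by
  rw [residuePart_mul]
  refine Finset.sum_eq_zero fun i _ => ?_
  rcases h i with h | h <;> simp [h]

theorem cphi_three_mul_modEq_zero (N : ℕ) {n : ℕ} (hn : (n : ZMod 3) ≠ 0) :
    cphi (3 * N) n ≡ 0 [MOD 3] := by
  refine cphi_modEq_zero (n + 1) N 0 (Nat.lt_succ_self n) fun j v _ hv _ => ?_
  rw [pow_zero, Polynomial.coeff_one]
  split_ifs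
  · rw [coeff_one, if_neg]
    rintro rfl
    exact hn (by rw [← hv, Nat.cast_zero])
  · simp

/-- When j ≡ M modulo p, the triangular number of j - M is 0 modulo p (p odd), so multiplying 1/E by
that power of q preserves the class. -/
theorem cphi_mul_add_one_modEq_zero {p : ℕ} [Fact p.Prime] (hp2 : (2 : ZMod p) ≠ 0) (N : ℕ)
    {n : ℕ} (H : residuePart (n : ZMod p) (pentagonalSeries (ZMod p))⁻¹ = 0) :
    cphi (p * N + 1) n ≡ 0 [MOD p] := by
  refine cphi_modEq_zero (2 * (n + 1)) N 1 (by omega) fun j v hvn hv hj => ?_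
  have h := X_pow_dvd_iff.1 (X_pow_dvd_thetaCoeff_sub (ZMod p) (le_refl (2 * (n + 1))) j) v
    (by omega)
  rw [map_sub, sub_eq_zero, thetaCoeff] at h
  rw [pow_one, h, coeff_X_pow_mul']
  split_ifs with hT
  · apply residuePart_eq_zero_iff.1 H
    have h2 := congrArg (Int.cast : ℤ → ZMod p) (two_mul_triangular (j - (2 * (n + 1) : ℕ)))
    push_cast at h2 hj
    rw [Nat.cast_sub hT, hv, sub_eq_self]
    apply mul_left_cancel₀ hp2
    push_cast
    rw [h2, hj]
    ring
  · rfl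

/-- The two factors contribute z-shifts u and -u modulo p, whose triangular numbers add up to u^2.
-/
theorem cphi_mul_add_two_modEq_zero {p : ℕ} [Fact p.Prime] (hp2 : (2 : ZMod p) ≠ 0) (N : ℕ)
    {n : ℕ} (H : ∀ u : ZMod p,
      residuePart ((n : ZMod p) - u ^ 2) ((pentagonalSeries (ZMod p))⁻¹ ^ 2) = 0) :
    cphi (p * N + 2) n ≡ 0 [MOD p] := by
  refine cphi_modEq_zero (2 * (n + 1)) N 2 (by omega) fun j v hvn hv hj => ?_
  rw [pow_two, Polynomial.coeff_mul, map_sum]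
  refine Finset.sum_eq_zero fun x hx => ?_
  rw [Finset.HasAntidiagonal.mem_antidiagonal] at hx
  have h1 := X_pow_dvd_thetaCoeff_sub (ZMod p) (le_refl (2 * (n + 1))) x.1
  have h2 := X_pow_dvd_thetaCoeff_sub (ZMod p) (le_refl (2 * (n + 1))) x.2
  rw [thetaCoeff] at h1 h2
  set s := triangular (x.1 - (2 * (n + 1) : ℕ)) with hs
  set t := triangular (x.2 - (2 * (n + 1) : ℕ)) with ht
  have h3 : X ^ (n + 1) ∣ (thetaProduct (ZMod p) (2 * (n + 1))).coeff x.1 *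
      (thetaProduct (ZMod p) (2 * (n + 1))).coeff x.2 -
      X ^ (s + t) * (pentagonalSeries (ZMod p))⁻¹ ^ 2 := by
    convert dvd_add (h1.mul_right ((thetaProduct (ZMod p) (2 * (n + 1))).coeff x.2))
      (h2.mul_left (X ^ s * (pentagonalSeries (ZMod p))⁻¹)) using 1
    ring
  have h := X_pow_dvd_iff.1 h3 v (by omega)
  rw [map_sub, sub_eq_zero] at h
  rw [h, coeff_X_pow_mul']
  split_ifs with hT
  · apply residuePart_eq_zero_iff.1 (H (x.1 - (2 * (n + 1) : ℕ)))
    have e1 := congrArg (Int.cast : ℤ → ZMod p) (two_mul_triangular (x.1 - (2 * (n + 1) : ℕ)))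
    have e2 := congrArg (Int.cast : ℤ → ZMod p) (two_mul_triangular (x.2 - (2 * (n + 1) : ℕ)))
    rw [← hs] at e1
    rw [← ht] at e2
    have e3 : (x.2 : ZMod p) = 2 * (2 * (n + 1) : ℕ) - x.1 := by
      rw [← hx] at hj
      push_cast at hj ⊢
      linear_combination hj
    push_cast at e1 e2 e3
    rw [Nat.cast_sub hT, hv]
    congr 1
    apply mul_left_cancel₀ hp2
    push_cast
    rw [e3] at e2
    linear_combination e1 + e2
  · rfl

theorem cphi_five_mul_add_two_modEq_zero (N : ℕ) {n : ℕ} (hn : (n : ZMod 5) = 3) :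
    cphi (5 * N + 2) n ≡ 0 [MOD 5] := by
  refine cphi_mul_add_two_modEq_zero (by decide) N fun u => ?_
  have h : (pentagonalSeries (ZMod 5))⁻¹ ^ 2 =
      pentagonalSeries (ZMod 5) ^ 3 * (pentagonalSeries (ZMod 5))⁻¹ ^ 5 := by
    have := congrArg (· ^ 3) (pentagonalSeries_mul_inv (ZMod 5))
    simp only [one_pow] at this
    linear_combination -(pentagonalSeries (ZMod 5))⁻¹ ^ 2 * this
  rw [h, residuePart_mul_pow_prime, residuePart_pentagonalSeries_cube, zero_mul]
  -- The classes c = 3 - u^2 are 3, 2, 4 modulo 5, where 8c + 1 is 0 or a nonresidue.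
  rw [hn]
  revert u
  decide

/-- Modulo 7, E^3 lives in the classes 0, 1, 3, no two of which (equal or not) add up to 5. -/
theorem cphi_seven_mul_add_one_modEq_zero (N : ℕ) {n : ℕ} (hn : (n : ZMod 7) = 5) :
    cphi (7 * N + 1) n ≡ 0 [MOD 7] := by
  refine cphi_mul_add_one_modEq_zero (by decide) N ?_
  have h : (pentagonalSeries (ZMod 7))⁻¹ = (pentagonalSeries (ZMod 7) ^ 3 *
      pentagonalSeries (ZMod 7) ^ 3) * (pentagonalSeries (ZMod 7))⁻¹ ^ 7 := by
    have := congrArg (· ^ 6) (pentagonalSeries_mul_inv (ZMod 7))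
    simp only [one_pow] at this
    linear_combination -(pentagonalSeries (ZMod 7))⁻¹ * this
  rw [h, residuePart_mul_pow_prime, residuePart_mul_eq_zero, zero_mul]
  intro i
  rw [hn]
  have : ∀ i : ZMod 7, (∀ x : ZMod 7, x ^ 2 = 8 * i + 1 → x = 0) ∨
    ∀ x : ZMod 7, x ^ 2 = 8 * (5 - i) + 1 → x = 0 := by decide
  exact (this i).imp residuePart_pentagonalSeries_cube residuePart_pentagonalSeries_cube

theorem residuePart_pentagonalSeries_eleven {c : ZMod 11}
    (hc : ∀ k : ZMod 11, 2 * c ≠ k * (3 * k - 1)) :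
    residuePart c (pentagonalSeries (ZMod 11)) = 0 := by
  refine residuePart_eq_zero_iff.2 fun d hd => coeff_pentagonalSeries_eq_zero _ ?_
  rintro ⟨k, rfl⟩
  have := congrArg (Int.cast : ℤ → ZMod 11) (two_mul_natCast_pentagonal k)
  push_cast at this
  exact hc k (by rw [← hd, this])

/-- The sequence of the parts of `f` indexed by the residue classes modulo `p`. -/
noncomputable def residueParts {R : Type*} [Semiring R] (p : ℕ) [NeZero p] (f : R⟦X⟧)
    (i : Fin p) : R⟦X⟧ :=
  residuePart (ZMod.finEquiv p i) f

theorem residueParts_mul {R : Type*} [Semiring R] {p : ℕ} [NeZero p] {f g : R⟦X⟧}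
    {F G : Fin p → R⟦X⟧} (hF : residueParts p f = F) (hG : residueParts p g = G) (i : Fin p) :
    residueParts p (f * g) i = ∑ j, F j * G (i - j) := by
  rw [residueParts, residuePart_mul, ← hF, ← hG]
  refine (Fintype.sum_equiv (ZMod.finEquiv p).toEquiv _ _ fun j => ?_).symm
  rw [residueParts, residueParts, map_sub]
  rfl

/-- Applied to f = E^3: then f^4 = E · E^11 lives in the classes of pentagonal numbers modulo 11.
Its missing classes give five quartic relations among the five parts of f, and the class 6 part of
f^7 lies in the ideal they generate modulo 11. -/
theorem residuePart_six_pow_seven (f : (ZMod 11)⟦X⟧)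
    (hf : ∀ c ∈ ({2, 4, 5, 7, 8, 9} : Finset (ZMod 11)), residuePart c f = 0)
    (hf4 : ∀ c ∈ ({3, 6, 8, 9, 10} : Finset (ZMod 11)), residuePart c (f ^ 4) = 0) :
    residuePart (6 : ZMod 11) (f ^ 7) = 0 := by
  obtain ⟨a, ha⟩ : ∃ a, residuePart (0 : ZMod 11) f = a := ⟨_, rfl⟩
  obtain ⟨b, hb⟩ : ∃ b, residuePart (1 : ZMod 11) f = b := ⟨_, rfl⟩
  obtain ⟨c, hc⟩ : ∃ c, residuePart (3 : ZMod 11) f = c := ⟨_, rfl⟩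
  obtain ⟨d, hd⟩ : ∃ d, residuePart (6 : ZMod 11) f = d := ⟨_, rfl⟩
  obtain ⟨e, he⟩ : ∃ e, residuePart (10 : ZMod 11) f = e := ⟨_, rfl⟩
  have h1 : residueParts 11 f = ![a, b, 0, c, 0, 0, d, 0, 0, 0, e] := by
    funext i
    fin_cases i
    exacts [ha, hb, hf 2 (by decide), hc, hf 4 (by decide), hf 5 (by decide), hd,
      hf 7 (by decide), hf 8 (by decide), hf 9 (by decide), he]
  have h2 : residueParts 11 (f * f) = ![a ^ 2 + 2 * b * e, 2 * a * b + d ^ 2,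
      b ^ 2 + 2 * c * e, 2 * a * c, 2 * b * c, 2 * d * e, 2 * a * d + c ^ 2, 2 * b * d, 0,
      2 * c * d + e ^ 2, 2 * a * e] := by
    funext i
    rw [residueParts_mul h1 h1]
    fin_cases i <;> simp [Fin.sum_univ_succ] <;> ring
  have h3 : residueParts 11 (f * f * f) = ![
      a ^ 3 + 6 * a * b * e + 3 * d ^ 2 * e, 3 * a ^ 2 * b + 3 * a * d ^ 2 + 3 * b ^ 2 * e
      + 3 * c ^ 2 * d + 3 * c * e ^ 2, 3 * a * b ^ 2 + 6 * a * c * e + 3 * b * d ^ 2, 3 * a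
      ^ 2 * c + b ^ 3 + 6 * b * c * e, 6 * a * b * c + 3 * c * d ^ 2 + 3 * d * e ^ 2, 6 * a
      * d * e + 3 * b ^ 2 * c + 3 * c ^ 2 * e, 3 * a ^ 2 * d + 3 * a * c ^ 2 + 6 * b * d *
      e, 6 * a * b * d + 3 * b * c ^ 2 + d ^ 3, 3 * b ^ 2 * d + 6 * c * d * e + e ^ 3, 6 *
      a * c * d + 3 * a * e ^ 2 + c ^ 3, 3 * a ^ 2 * e + 6 * b * c * d + 3 * b * e ^ 2] := by
    funext i
    rw [residueParts_mul h2 h1]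
    fin_cases i <;> simp [Fin.sum_univ_succ] <;> ring
  have h4 : residueParts 11 (f * f * (f * f)) = ![
      a ^ 4 + 12 * a ^ 2 * b * e + 12 * a * d ^ 2 * e + 12 * b ^ 2 * c * d + 6 * b ^ 2 * e
      ^ 2 + 12 * c ^ 2 * d * e + 4 * c * e ^ 3, 4 * a ^ 3 * b + 6 * a ^ 2 * d ^ 2 + 12 * a
      * b ^ 2 * e + 12 * a * c ^ 2 * d + 12 * a * c * e ^ 2 + 12 * b * d ^ 2 * e + c ^ 4, 6
      * a ^ 2 * b ^ 2 + 12 * a ^ 2 * c * e + 12 * a * b * d ^ 2 + 4 * b ^ 3 * e + 12 * b *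
      c ^ 2 * d + 12 * b * c * e ^ 2 + d ^ 4, 4 * a ^ 3 * c + 4 * a * b ^ 3 + 24 * a * b *
      c * e + 6 * b ^ 2 * d ^ 2 + 12 * c * d ^ 2 * e + 4 * d * e ^ 3, 12 * a ^ 2 * b * c +
      12 * a * c * d ^ 2 + 12 * a * d * e ^ 2 + b ^ 4 + 12 * b ^ 2 * c * e + 4 * c ^ 3 * d
      + 6 * c ^ 2 * e ^ 2, 12 * a ^ 2 * d * e + 12 * a * b ^ 2 * c + 12 * a * c ^ 2 * e +
      12 * b * c * d ^ 2 + 12 * b * d * e ^ 2, 4 * a ^ 3 * d + 6 * a ^ 2 * c ^ 2 + 24 * a *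
      b * d * e + 4 * b ^ 3 * c + 12 * b * c ^ 2 * e + 4 * d ^ 3 * e, 12 * a ^ 2 * b * d +
      12 * a * b * c ^ 2 + 4 * a * d ^ 3 + 12 * b ^ 2 * d * e + 6 * c ^ 2 * d ^ 2 + 12 * c
      * d * e ^ 2 + e ^ 4, 12 * a * b ^ 2 * d + 24 * a * c * d * e + 4 * a * e ^ 3 + 6 * b
      ^ 2 * c ^ 2 + 4 * b * d ^ 3 + 4 * c ^ 3 * e, 12 * a ^ 2 * c * d + 6 * a ^ 2 * e ^ 2 +
      4 * a * c ^ 3 + 4 * b ^ 3 * d + 24 * b * c * d * e + 4 * b * e ^ 3, 4 * a ^ 3 * e +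
      24 * a * b * c * d + 12 * a * b * e ^ 2 + 4 * b * c ^ 3 + 4 * c * d ^ 3 + 6 * d ^ 2 *
      e ^ 2] := by
    funext i
    rw [residueParts_mul h2 h2]
    fin_cases i <;> simp [Fin.sum_univ_succ] <;> ring
  rw [show f ^ 4 = f * f * (f * f) by ring] at hf4
  have r3 := (congrFun h4 3).symm.trans (hf4 3 (by decide))
  have r6 := (congrFun h4 6).symm.trans (hf4 6 (by decide))
  have r8 := (congrFun h4 8).symm.trans (hf4 8 (by decide))
  have r9 := (congrFun h4 9).symm.trans (hf4 9 (by decide))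
  have r10 := (congrFun h4 10).symm.trans (hf4 10 (by decide))
  simp only [Matrix.cons_val] at r3 r6 r8 r9 r10
  have h11 : (11 : (ZMod 11)⟦X⟧) = 0 := by exact_mod_cast CharP.cast_eq_zero (ZMod 11)⟦X⟧ 11
  rw [show f ^ 7 = f * f * (f * f) * (f * f * f) by ring]
  refine (residueParts_mul h4 h3 6).trans ?_
  simp [Fin.sum_univ_succ]
  -- Certificate of ideal membership: the relation of class s gets a cubic multiplier of class 6 -
  -- s, and the remainder is divisible by 11.
  linear_combination
    (4 * a ^ 2 * c - b ^ 3 - b * c * e) * r3 + (-a ^ 3 - a * b * e + 4 * d ^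
    2 * e) * r6 + (-a * c * d + 4 * a * e ^ 2 - c ^ 3) * r8 + (4 * b ^ 2 * d - c
    * d * e - e ^ 3) * r9 + (-a * b * d + 4 * b * c ^ 2 - d ^ 3) * r10 + (a ^ 6 *
    d + a ^ 5 * c ^ 2 + 22 * a ^ 4 * b * d * e + 12 * a ^ 3 * b ^ 3 * c + 30 * a ^ 3 * b * c
    ^ 2 * e + 12 * a ^ 3 * d ^ 3 * e + 54 * a ^ 2 * b ^ 2 * c * d ^ 2 + 54 * a ^ 2 * b ^ 2 *
    d * e ^ 2 + 54 * a ^ 2 * c ^ 2 * d ^ 2 * e + 30 * a ^ 2 * c * d * e ^ 3 + a ^ 2 * e ^ 5 +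
    a * b ^ 6 + 22 * a * b ^ 4 * c * e + 30 * a * b ^ 2 * c ^ 3 * d + 54 * a * b ^ 2 * c ^ 2
    * e ^ 2 + 22 * a * b * c * d ^ 4 + 30 * a * b * d ^ 3 * e ^ 2 + 22 * a * c ^ 4 * d * e +
    12 * a * c ^ 3 * e ^ 3 + b ^ 5 * d ^ 2 + 30 * b ^ 3 * c * d ^ 2 * e + 12 * b ^ 3 * d * e
    ^ 3 + b ^ 2 * c ^ 5 + 12 * b * c ^ 3 * d ^ 3 + 54 * b * c ^ 2 * d ^ 2 * e ^ 2 + 22 * b *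
    c * d * e ^ 4 + b * e ^ 6 + c ^ 6 * e + c * d ^ 6 + d ^ 5 * e ^ 2) * h11

theorem cphi_eleven_mul_add_one_modEq_zero (N : ℕ) {n : ℕ} (hn : (n : ZMod 11) = 6) :
    cphi (11 * N + 1) n ≡ 0 [MOD 11] := by
  refine cphi_mul_add_one_modEq_zero (by decide) N ?_
  -- 21 is the least positive exponent that is divisible by 3 and ≡ -1 modulo 11.
  have h : (pentagonalSeries (ZMod 11))⁻¹ = (pentagonalSeries (ZMod 11) ^ 3) ^ 7 *
      ((pentagonalSeries (ZMod 11))⁻¹ ^ 2) ^ 11 := by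
    have := congrArg (· ^ 21) (pentagonalSeries_mul_inv (ZMod 11))
    simp only [one_pow] at this
    linear_combination -(pentagonalSeries (ZMod 11))⁻¹ * this
  rw [h, residuePart_mul_pow_prime, hn, residuePart_six_pow_seven, zero_mul]
  · intro c hc
    apply residuePart_pentagonalSeries_cube
    revert c
    decide
  · intro c hc
    rw [show (pentagonalSeries (ZMod 11) ^ 3) ^ 4 =
      pentagonalSeries (ZMod 11) * pentagonalSeries (ZMod 11) ^ 11 by ring,
      residuePart_mul_pow_prime, residuePart_pentagonalSeries_eleven, zero_mul]
    revert c
    decide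

end Congruences

theorem corollary4 (N n : ℕ) :
    cphi (1155 * N + 1002) (1155 * n + 908) ≡ 0 [MOD 1155] := by
  have h3 : cphi (3 * (385 * N + 334)) (1155 * n + 908) ≡ 0 [MOD 3] :=
    cphi_three_mul_modEq_zero _ (by push_cast; reduce_mod_char; decide)
  have h5 : cphi (5 * (231 * N + 200) + 2) (1155 * n + 908) ≡ 0 [MOD 5] :=
    cphi_five_mul_add_two_modEq_zero _ (by push_cast; reduce_mod_char)
  have h7 : cphi (7 * (165 * N + 143) + 1) (1155 * n + 908) ≡ 0 [MOD 7] :=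
    cphi_seven_mul_add_one_modEq_zero _ (by push_cast; reduce_mod_char)
  have h11 : cphi (11 * (105 * N + 91) + 1) (1155 * n + 908) ≡ 0 [MOD 11] :=
    cphi_eleven_mul_add_one_modEq_zero _ (by push_cast; reduce_mod_char)
  rw [Nat.modEq_zero_iff_dvd] at *
  rw [show 3 * (385 * N + 334) = 1155 * N + 1002 by ring] at h3
  rw [show 5 * (231 * N + 200) + 2 = 1155 * N + 1002 by ring] at h5
  rw [show 7 * (165 * N + 143) + 1 = 1155 * N + 1002 by ring] at h7
  rw [show 11 * (105 * N + 91) + 1 = 1155 * N + 1002 by ring] at h11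
  omega
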